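/- Let $\Phi\in\mathbb R^{m\times n}$ have columns (atoms) $\phi_1,\dots,\phi_n$ with $\|\phi_j\|_2=1$. Let $x_1,x_2,\dots\in\mathbb R^n$ be deterministic signals, write $X_{j,k}$ for the $j$-th entry of $x_k$, and let $\mathcal S=\bigcup_k\operatorname{supp}(x_k)$ be their joint support. Let $\sigma_1>0$ and $\sigma_k\ge0$ for $k\ge 2$, let $e_k\sim\mathcal N(0,\sigma_k^2 I_m)$ be independent, and let $y_k=\Phi x_k+e_k$. For $T\subseteq[n]$ let $P_T$ be the orthogonal projector of $\mathbb R^m$ onto $\operatorname{span}\{\phi_j:j\in T\}$. Given $K\ge1$, SOMP starts with $\mathcal S_0=\emptyset$ and at each iteration $t=0,1,\dots$ picks an index $j_t$ maximizing $\sum_{k=1}^K|\langle\phi_j,(I-P_{\mathcal S_t})y_k\rangle|$ over $j\in[n]$ (ties broken arbitrarily) and sets $\mathcal S_{t+1}=\mathcal S_t\cup\{j_t\}$. Fix $0\le s<|\mathcal S|$; SOMP *errs* if $j_t\notin\mathcal S$ for some $t\in\{0,\dots,s\}$. For $T\subseteq\mathcal S$ and $K\ge1$ let $\gamma_c^{K,T}=\max_{j\in\mathcal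 S}\sum_{k=1}^K|\langle\phi_j,(I-P_T)\Phi x_k\rangle|$, let $\gamma_i^{K,T}$ be the same maximum over $j\notin\mathcal S$ ($0$ if $\mathcal S=[n]$), and let $\tau_X(K)=\min_{j\in\mathcal S}\sum_{k=1}^K|X_{j,k}|$. Call $(\Gamma,\psi)$, with $\Gamma>1$ and $\psi\in\mathbb R$, *admissible for $K$* if for all $T\subseteq\mathcal S$ with $|T|\le s$ $$\gamma_c^{K,T}\ge\Gamma\,\gamma_i^{K,T}\qquad\text{and}\qquad \gamma_c^{K,T}\ge\psi\,\tau_X(K).$$ Let $$\mathrm{SNR}_{\min}=\inf_{K\ge1}\frac{\min_{j\in\mathcal S}\frac1K\sum_{k=1}^K|X_{j,k}|}{\big(\frac1K\sum_{k=1}^K\sigma_k^2\big)^{1/2}},\qquad \omega_\sigma=\sup_{K\ge1}\frac{1}{\sqrt K}\,\frac{\sum_{k=1}^K\sigma_k}{\big(\sum_{k=1}^K\sigma_k^2\big)^{1/2}},$$ $$\xi=\Big(1-\frac1\Gamma\Big)\psi\,\mathrm{SNR}_{\min}-\sqrt{\frac2\pi}\,\omega_\sigma,\qquad \mathcal C_s=\sum_{t=0}^s\binom{|\mathcal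 S|}{t},$$ and assume $\xi>0$. Then: 1. If $(\Gamma,\psi)$ is admissible for $K\ge1$, then the probability that SOMP, run on $y_1,\dots,y_K$, errs is at most $n\,\mathcal C_s\exp(-K\xi^2/8)$. If in addition $p_{\mathrm{err}}>0$ and $K>\frac{8}{\xi^2}\log\frac{n\,\mathcal C_s}{p_{\mathrm{err}}}$, then this probability is smaller than $p_{\mathrm{err}}$. 2. If $(\Gamma,\psi)$ is admissible for all sufficiently large $K$, then the probability that SOMP errs tends to $0$ as $K\to\infty$. Moreover (regardless of $\xi$), let $\delta$ be the restricted isometry constant of $\Phi$ of order $|\mathcal S|$, i.e. the smallest $\delta$ with $(1-\delta)\|u\|_2^2\le\|\Phi u\|_2^2\le(1+\delta)\|u\|_2^2$ for all $u\in\mathbb R^n$ with at most $|\mathcal S|$ nonzero entries. If $\delta<1$, then $\psi=\frac{(1-\delta)(1+\delta)}{1+\sqrt{|\mathcal S|}\,\delta}$ satisfies $\gamma_c^{K,T}\ge\psi\,\tau_X(K)$ for all $K\ge1$ and all $T\subseteq\mathcal S$ with $|T|\le s$. -/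

import Mathlib

open MeasureTheory ProbabilityTheory Filter Topology

namespace SOMP

/-- The `j`-th atom (column) of the measurement matrix, as a Euclidean vector. -/
noncomputable def atom {m n : ℕ} (Φ : Matrix (Fin m) (Fin n) ℝ) (j : Fin n) :
    EuclideanSpace ℝ (Fin m) :=
  WithLp.toLp 2 (fun i => Φ i j)

/-! ### The algorithm -/

/-- The orthogonal projector onto the span of the atoms indexed by `T`, that is, `Φ_T Φ_T⁺`.
It is the zero map for `T = ∅`. -/
noncomputable def proj {m n : ℕ} (Φ : Matrix (Fin m) (Fin n) ℝ) (T : Finset (Fin n)) :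
    EuclideanSpace ℝ (Fin m) →L[ℝ] EuclideanSpace ℝ (Fin m) :=
  (Submodule.span ℝ (atom Φ '' (T : Set (Fin n)))).starProjection

/-- The residual matrix `(I - P) Y` for the projector `P` of the support `T`, column by column. -/
noncomputable def residual {m n K : ℕ} (Φ : Matrix (Fin m) (Fin n) ℝ) (T : Finset (Fin n))
    (Y : Fin K → EuclideanSpace ℝ (Fin m)) (k : Fin K) : EuclideanSpace ℝ (Fin m) :=
  Y k - proj Φ T (Y k)

/-- The SOMP metric `‖Rᵀ φ_j‖₁ = ∑ₖ |⟨φ_j, r_k⟩|` of the `j`-th atom. -/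
noncomputable def metric {m n K : ℕ} (Φ : Matrix (Fin m) (Fin n) ℝ)
    (R : Fin K → EuclideanSpace ℝ (Fin m)) (j : Fin n) : ℝ :=
  ∑ k, |inner ℝ (atom Φ j) (R k)|

/-- The estimated support `S_t = {j_0, …, j_{t-1}}` before iteration `t`. -/
def estSupport {n : ℕ} (j : ℕ → Fin n) (t : ℕ) : Finset (Fin n) :=
  (Finset.range t).image j

/-- `j 0, …, j s` are indices that SOMP may pick in iterations `0, …, s` on the measurements `Y`:
at each iteration the picked atom maximizes the SOMP metric of the current residual
(ties may be broken in any way). -/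
def IsRun {m n K : ℕ} (Φ : Matrix (Fin m) (Fin n) ℝ) (Y : Fin K → EuclideanSpace ℝ (Fin m))
    (s : ℕ) (j : ℕ → Fin n) : Prop :=
  ∀ t ≤ s, ∀ i : Fin n,
    metric Φ (residual Φ (estSupport j t) Y) i ≤ metric Φ (residual Φ (estSupport j t) Y) (j t)

/-- SOMP may pick an index outside `S` in one of the iterations `0, …, s`: for some way of breaking
ties it does. When no tie occurs, there is only one run. -/
def Errs {m n K : ℕ} (Φ : Matrix (Fin m) (Fin n) ℝ) (Y : Fin K → EuclideanSpace ℝ (Fin m))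
    (S : Finset (Fin n)) (s : ℕ) : Prop :=
  ∃ j : ℕ → Fin n, IsRun Φ Y s j ∧ ∃ t ≤ s, j t ∉ S

/-! ### The signal model. Column `k` of `X` is the `k`-th sparse signal; indices start at `0`. -/

open Classical in
/-- The joint support of the sparse signals. -/
noncomputable def jointSupport {n : ℕ} (X : Matrix (Fin n) ℕ ℝ) : Finset (Fin n) :=
  Finset.univ.filter fun j => ∃ k, X j k ≠ 0

/-- The noiseless measurements `Φ x_k` of the first `K` signals. -/
noncomputable def cleanMeas {m n : ℕ} (Φ : Matrix (Fin m) (Fin n) ℝ) (X : Matrix (Fin n) ℕ ℝ)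
    (K : ℕ) (k : Fin K) : EuclideanSpace ℝ (Fin m) :=
  WithLp.toLp 2 (Φ.mulVec fun j => X j k)

/-- The noisy measurements `y_k = Φ x_k + e_k` of the first `K` signals. -/
noncomputable def noisyMeas {m n : ℕ} (Φ : Matrix (Fin m) (Fin n) ℝ) (X : Matrix (Fin n) ℕ ℝ)
    (e : ℕ → EuclideanSpace ℝ (Fin m)) (K : ℕ) (k : Fin K) : EuclideanSpace ℝ (Fin m) :=
  cleanMeas Φ X K k + e k

/-! ### Noiseless reliability -/

/-- `γ_c`: the largest noiseless metric of a correct atom, for the projector of `T`. -/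
noncomputable def gammaC {m n : ℕ} (Φ : Matrix (Fin m) (Fin n) ℝ) (X : Matrix (Fin n) ℕ ℝ)
    (K : ℕ) (T : Finset (Fin n)) : ℝ :=
  ⨆ j : {j : Fin n // j ∈ jointSupport X}, metric Φ (residual Φ T (cleanMeas Φ X K)) j

/-- `γ_i`: the largest noiseless metric of an incorrect atom, for the projector of `T`
(`0` if there is no incorrect atom). -/
noncomputable def gammaI {m n : ℕ} (Φ : Matrix (Fin m) (Fin n) ℝ) (X : Matrix (Fin n) ℕ ℝ)
    (K : ℕ) (T : Finset (Fin n)) : ℝ :=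
  ⨆ j : {j : Fin n // j ∉ jointSupport X}, metric Φ (residual Φ T (cleanMeas Φ X K)) j

/-- `τ_X = min_{j ∈ S} ∑_{k ≤ K} |X_{j,k}|`. -/
noncomputable def tauX {n : ℕ} (X : Matrix (Fin n) ℕ ℝ) (K : ℕ) : ℝ :=
  ⨅ j : {j : Fin n // j ∈ jointSupport X}, ∑ k ∈ Finset.range K, |X j k|

/-- `γ_c / γ_i ≥ Γ` for all iterations `t ∈ [0, s]` and all `T ⊆ S` with `|T| = t`
(as a product, so that `γ_i = 0` is allowed). -/
def RelativelyReliable {m n : ℕ} (Φ : Matrix (Fin m) (Fin n) ℝ) (X : Matrix (Fin n) ℕ ℝ)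
    (s : ℕ) (Γ : ℝ) (K : ℕ) : Prop :=
  ∀ t ≤ s, ∀ T ∈ (jointSupport X).powersetCard t, Γ * gammaI Φ X K T ≤ gammaC Φ X K T

/-- `γ_c ≥ ψ τ_X` for all iterations `t ∈ [0, s]` and all `T ⊆ S` with `|T| = t`. -/
def CorrectMetricBound {m n : ℕ} (Φ : Matrix (Fin m) (Fin n) ℝ) (X : Matrix (Fin n) ℕ ℝ)
    (s : ℕ) (ψ : ℝ) (K : ℕ) : Prop :=
  ∀ t ≤ s, ∀ T ∈ (jointSupport X).powersetCard t, ψ * tauX X K ≤ gammaC Φ X K T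

open Classical in
/-- The restricted isometry constant of order `r`: the smallest `δ` with
`(1 - δ) ‖u‖² ≤ ‖Φ u‖² ≤ (1 + δ) ‖u‖²` for all `r`-sparse `u`. -/
noncomputable def ric {m n : ℕ} (Φ : Matrix (Fin m) (Fin n) ℝ) (r : ℕ) : ℝ :=
  sInf {δ : ℝ | ∀ u : EuclideanSpace ℝ (Fin n), (Finset.univ.filter fun j => u j ≠ 0).card ≤ r →
    (1 - δ) * ‖u‖ ^ 2 ≤ ‖(WithLp.toLp 2 (Φ.mulVec u.ofLp) : EuclideanSpace ℝ (Fin m))‖ ^ 2 ∧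
    ‖(WithLp.toLp 2 (Φ.mulVec u.ofLp) : EuclideanSpace ℝ (Fin m))‖ ^ 2 ≤ (1 + δ) * ‖u‖ ^ 2}

/-- `(1 - δ) (1 + δ) / (1 + √r δ)` with `δ` the restricted isometry constant of order `r`. -/
noncomputable def psiRIC {m n : ℕ} (Φ : Matrix (Fin m) (Fin n) ℝ) (r : ℕ) : ℝ :=
  (1 - ric Φ r) * (1 + ric Φ r) / (1 + √r * ric Φ r)

/-! ### Signal-to-noise quantities -/

/-- `μ_X(K) = min_{j ∈ S} (1/K) ∑_{k ≤ K} |X_{j,k}|`. -/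
noncomputable def muX {n : ℕ} (X : Matrix (Fin n) ℕ ℝ) (K : ℕ) : ℝ :=
  ⨅ j : {j : Fin n // j ∈ jointSupport X}, (1 / (K : ℝ)) * ∑ k ∈ Finset.range K, |X j k|

/-- `σ(K) = ((1/K) ∑_{k ≤ K} σ_k²)^{1/2}`. -/
noncomputable def sigmaAvg (σ : ℕ → ℝ) (K : ℕ) : ℝ :=
  √((1 / (K : ℝ)) * ∑ k ∈ Finset.range K, σ k ^ 2)

/-- `SNR_min`, the infimum over `1 ≤ K < ∞` of `μ_X(K) / σ(K)`. -/
noncomputable def snrMin {n : ℕ} (X : Matrix (Fin n) ℕ ℝ) (σ : ℕ → ℝ) : ℝ :=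
  ⨅ K : ℕ+, muX X K / sigmaAvg σ K

/-- `ω_σ`, the supremum over `1 ≤ K < ∞` of `(1/√K) ‖(σ_1, …, σ_K)‖₁ / ‖(σ_1, …, σ_K)‖₂`. -/
noncomputable def omegaSigma (σ : ℕ → ℝ) : ℝ :=
  ⨆ K : ℕ+, (1 / √((K : ℕ) : ℝ)) *
    ((∑ k ∈ Finset.range K, |σ k|) / √(∑ k ∈ Finset.range K, σ k ^ 2))

/-- `ξ = (1 - 1/Γ) ψ SNR_min - √(2/π) ω_σ`. -/
noncomputable def xi {n : ℕ} (X : Matrix (Fin n) ℕ ℝ) (σ : ℕ → ℝ) (Γ ψ : ℝ) : ℝ :=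
  (1 - 1 / Γ) * ψ * snrMin X σ - √(2 / Real.pi) * omegaSigma σ

/-- `C_s = ∑_{t=0}^s (|S| choose t)` for a support of cardinality `r = |S|`. -/
def numProj (r s : ℕ) : ℕ :=
  ∑ t ∈ Finset.range (s + 1), r.choose t

/-- `K_min(p) = (8/ξ²) log(n C_s / p)`. -/
noncomputable def kMin {n : ℕ} (X : Matrix (Fin n) ℕ ℝ) (σ : ℕ → ℝ) (s : ℕ) (Γ ψ p : ℝ) : ℝ :=
  8 / xi X σ Γ ψ ^ 2 * Real.log (n * numProj (jointSupport X).card s / p)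

/-- The probability that SOMP, run on the first `K` noisy measurement vectors, picks at least one
incorrect atom in the iterations `0, …, s`. -/
noncomputable def failProb {Ω : Type*} [MeasurableSpace Ω] (μ : Measure Ω) {m n : ℕ}
    (Φ : Matrix (Fin m) (Fin n) ℝ) (X : Matrix (Fin n) ℕ ℝ)
    (e : ℕ → Ω → EuclideanSpace ℝ (Fin m)) (s K : ℕ) : ℝ :=
  μ.real {w | Errs Φ (noisyMeas Φ X (fun k => e k w) K) (jointSupport X) s}

end SOMP

/-!
Both noise statements compare metrics at the first iteration that picks an incorrect atom. Until
then the estimated support is some `T ⊆ S` with `|T| ≤ s` (`Errs.exists_first`). For this `T` the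
metric of an atom is `∑ₖ |cₖ + gₖ|`, with `cₖ` the noiseless correlations and `gₖ` independent
centred Gaussians of variance at most `σₖ²`, because the projected atoms have norm at most `1`.

The two tails of such a sum are treated differently. Above, `|c + g| ≤ |c| + |g|`, and the moment
generating function of `|g|` is at most that of a Gaussian with the same mean `√(2/π) σ`
(`integral_exp_mul_abs_gaussianReal_le`). Below, `|c + g| ≥ |c| + sign c * g`, which involves no
mean shift at all. Hence the mean of the noise enters only once, through the incorrect atom, and
what separates the best correct atom from the incorrect ones is at least
`γ_c - γ_i - √(2/π) ∑ σₖ ≥ √(K ∑ σₖ²) ξ` (`xi_mul_le_gammaC_sub`). An error forces one of the two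
sums to deviate by half of this, and the Chernoff bound `measureReal_sum_ge_le` gives
`exp (-K ξ² / 8)` for each; the union over the `n` atoms and the `C_s` sets `T` is `failProb_le`.

For the restricted isometry bound, let `G` be the Gram matrix of the atoms in `S`, and take an index
`i ∈ S` outside `T`. With `w` the `i`-th column of `G⁻¹`, the vector `Φ w` is orthogonal to every
atom of `S` except `φ_i`, so it is fixed by `I - P_T`, and the coordinate `i` of each signal is
`∑ⱼ wⱼ ⟨φⱼ, (I - P_T) Φ x⟩` (`exists_dual_coefficients`). Thus `τ_X ≤ ‖w‖₁ γ_c`. The spectrum of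
`G⁻¹` lies in `[1 / (1 + δ), 1 / (1 - δ)]`, so `G⁻¹` differs from `1 / (1 - δ²)` by at most
`δ / (1 - δ²)` in operator norm, which yields `‖w‖₁ ≤ (1 + √|S| δ) / (1 - δ²)`.
-/

namespace SOMP

open scoped NNReal RealInnerProductSpace

/-! ### The modulus of a Gaussian -/

lemma integral_Ioi_gaussianPDFReal_zero (v : ℝ≥0) (hv : v ≠ 0) :
    2 * ∫ x in Set.Ioi (0 : ℝ), gaussianPDFReal 0 v x = 1 := by
  rw [← integral_comp_abs, ← integral_gaussianPDFReal_eq_one 0 hv]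
  simp [gaussianPDFReal]

lemma gaussianPDFReal_le (m : ℝ) (v : ℝ≥0) (x : ℝ) :
    gaussianPDFReal m v x ≤ (√(2 * Real.pi * v))⁻¹ := by
  rw [gaussianPDFReal]
  refine mul_le_of_le_one_right (by positivity) (Real.exp_le_one_iff.2 ?_)
  rw [neg_div]
  exact neg_nonpos.2 (by positivity)

lemma integral_Ioi_gaussianPDFReal_le {m : ℝ} (hm : 0 ≤ m) (v : ℝ≥0) (hv : v ≠ 0) :
    ∫ x in Set.Ioi (0 : ℝ), gaussianPDFReal m v x ≤ 1 / 2 + m * (√(2 * Real.pi * v))⁻¹ := by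
  have h1 : ∫ x in Set.Ioi (0 : ℝ), gaussianPDFReal m v x =
      ∫ x in Set.Ioi (-m), gaussianPDFReal 0 v x := by
    have h := (measurePreserving_sub_right volume m).setIntegral_preimage_emb
      (MeasurableEquiv.subRight m).measurableEmbedding (gaussianPDFReal 0 v) (Set.Ioi (-m))
    rw [← h]
    simp [gaussianPDFReal]
  have hint := integrable_gaussianPDFReal 0 v
  rw [h1, ← Set.Ioc_union_Ioi_eq_Ioi (neg_nonpos.2 hm),
    setIntegral_union (Set.Ioc_disjoint_Ioi le_rfl) measurableSet_Ioi hint.integrableOn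
      hint.integrableOn]
  have h2 : ∫ x in Set.Ioc (-m) 0, gaussianPDFReal 0 v x ≤ m * (√(2 * Real.pi * v))⁻¹ := by
    calc ∫ x in Set.Ioc (-m) 0, gaussianPDFReal 0 v x
        ≤ ∫ x in Set.Ioc (-m) 0, (√(2 * Real.pi * v))⁻¹ :=
          setIntegral_mono hint.integrableOn (integrableOn_const (by simp)) (gaussianPDFReal_le 0 v)
      _ = m * (√(2 * Real.pi * v))⁻¹ := by simp [hm]
  have h3 := integral_Ioi_gaussianPDFReal_zero v hv
  linarith

lemma integrable_exp_mul_abs_gaussianReal (v : ℝ≥0) (t : ℝ) :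
    Integrable (fun x ↦ Real.exp (t * |x|)) (gaussianReal 0 v) := by
  refine ((integrable_exp_mul_gaussianReal t).add (integrable_exp_mul_gaussianReal (-t))).mono'
    (by fun_prop) (.of_forall fun x ↦ ?_)
  rw [Real.norm_of_nonneg (by positivity)]
  have h1 := Real.exp_pos (t * x)
  have h2 := Real.exp_pos (-t * x)
  simp only [Pi.add_apply]
  rcases abs_cases x with ⟨h, _⟩ | ⟨h, _⟩ <;> rw [h]
  · linarith
  · rw [mul_neg, ← neg_mul]
    linarith

/-- The moment generating function of the modulus of a centred Gaussian is at most that of a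
Gaussian of the same proxy variance whose mean is that of the modulus. It equals
`2 exp (t² v / 2) P(N(t v, v) > 0)`, and `2 P(N(t v, v) > 0) ≤ 1 + t √(2 v / π)`. -/
lemma integral_exp_mul_abs_gaussianReal_le (v : ℝ≥0) {t : ℝ} (ht : 0 ≤ t) :
    ∫ x, Real.exp (t * |x|) ∂(gaussianReal 0 v) ≤
      Real.exp (t * (√(2 / Real.pi) * √v) + t ^ 2 * v / 2) := by
  by_cases hv : v = 0
  · subst hv; simp
  have hv0 : (0 : ℝ) < v := by positivity
  rw [integral_gaussianReal_eq_integral_smul hv]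
  have h1 : ∀ x : ℝ, gaussianPDFReal 0 v x • Real.exp (t * |x|) =
      (fun y ↦ Real.exp (t ^ 2 * v / 2) * gaussianPDFReal (t * v) v y) |x| := by
    intro x
    simp only [gaussianPDFReal, smul_eq_mul, sub_zero]
    rw [mul_assoc, mul_left_comm (Real.exp _), ← Real.exp_add, ← Real.exp_add]
    congr 2
    rw [← sq_abs x]
    field_simp
    ring
  simp_rw [h1]
  rw [integral_comp_abs (f := fun y ↦ Real.exp (t ^ 2 * v / 2) * gaussianPDFReal (t * v) v y),
    integral_const_mul, Real.exp_add]
  have h2 := integral_Ioi_gaussianPDFReal_le (mul_nonneg ht hv0.le) v hv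
  have h3 : 2 * (t * v * (√(2 * Real.pi * v))⁻¹) = t * (√(2 / Real.pi) * √v) := by
    have : √(2 / Real.pi) * √v = 2 * v / √(2 * Real.pi * v) := by
      rw [← Real.sqrt_mul (by positivity), eq_div_iff (by positivity),
        ← Real.sqrt_mul (by positivity), Real.sqrt_eq_iff_mul_self_eq (by positivity) (by positivity)]
      field_simp
    rw [this]; ring
  have h4 := Real.add_one_le_exp (t * (√(2 / Real.pi) * √v))
  have h5 := Real.exp_pos (t ^ 2 * v / 2)
  nlinarith

/-! ### Chernoff bound -/

/-- The Chernoff bound for a sum of independent variables which are one-sidedly sub-Gaussian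
about given centres `b k`, which need not be their means. -/
lemma measureReal_sum_ge_le {Ω : Type*} [MeasurableSpace Ω] {μ : Measure Ω}
    [IsProbabilityMeasure μ] {Z : ℕ → Ω → ℝ} (hZ : iIndepFun Z μ) (hm : ∀ k, AEMeasurable (Z k) μ)
    {b v : ℕ → ℝ}
    (hint : ∀ k t, Integrable (fun w ↦ Real.exp (t * Z k w)) μ)
    (hmgf : ∀ k t, 0 ≤ t → mgf (Z k) μ t ≤ Real.exp (t * b k + t ^ 2 * v k / 2))
    (s : Finset ℕ) (hv : 0 < ∑ k ∈ s, v k) {ε : ℝ} (hε : 0 ≤ ε) :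
    μ.real {w | ∑ k ∈ s, b k + ε ≤ ∑ k ∈ s, Z k w} ≤
      Real.exp (-(ε ^ 2 / (2 * ∑ k ∈ s, v k))) := by
  set V := ∑ k ∈ s, v k with hV
  -- The minimizer of `-t ε + t² V / 2`.
  set t := ε / V with ht
  have ht0 : 0 ≤ t := by positivity
  have h1 := measure_ge_le_exp_mul_mgf (μ := μ) (X := ∑ k ∈ s, Z k) (∑ k ∈ s, b k + ε) ht0
    -- The product formula makes the moment generating function of the sum nonzero, and it would
    -- have the junk value `0` without integrability.
    (mgf_pos_iff.1 (by
      rw [hZ.mgf_sum₀ hm]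
      exact Finset.prod_pos fun k _ ↦ mgf_pos (hint k t)))
  simp only [Finset.sum_apply] at h1
  refine h1.trans ?_
  rw [hZ.mgf_sum₀ hm]
  calc Real.exp (-t * (∑ k ∈ s, b k + ε)) * ∏ k ∈ s, mgf (Z k) μ t
      ≤ Real.exp (-t * (∑ k ∈ s, b k + ε)) *
          ∏ k ∈ s, Real.exp (t * b k + t ^ 2 * v k / 2) := by
        gcongr with k _
        · exact fun _ _ ↦ mgf_nonneg
        · exact hmgf k t ht0
    _ = Real.exp (-(ε ^ 2 / (2 * V))) := by
        rw [← Real.exp_sum, ← Real.exp_add, Finset.sum_add_distrib, ← Finset.mul_sum,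
          ← Finset.sum_div, ← Finset.mul_sum, ← hV, ht]
        congr 1
        field_simp
        ring

/-! ### The modulus of a shifted Gaussian -/

lemma mgf_abs_const_add_le {Ω : Type*} [MeasurableSpace Ω] {μ : Measure Ω}
    [IsProbabilityMeasure μ] {g : Ω → ℝ} {v : ℝ≥0} (hg : HasLaw g (gaussianReal 0 v) μ)
    (c : ℝ) {τ : ℝ} (hτ : 0 ≤ τ) (hv : (v : ℝ) ≤ τ ^ 2) {t : ℝ} (ht : 0 ≤ t) :
    mgf (fun w ↦ |c + g w|) μ t ≤
      Real.exp (t * (|c| + √(2 / Real.pi) * τ) + t ^ 2 * τ ^ 2 / 2) := by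
  have hlaw : ∫ w, Real.exp (t * |g w|) ∂μ = ∫ x, Real.exp (t * |x|) ∂(gaussianReal 0 v) :=
    hg.integral_comp (f := fun x ↦ Real.exp (t * |x|)) (by fun_prop)
  have hint : Integrable (fun w ↦ Real.exp (t * |g w|)) μ := by
    have h := integrable_exp_mul_abs_gaussianReal v t
    rw [← hg.map_eq] at h
    exact h.comp_aemeasurable hg.aemeasurable
  have hsq : √(v : ℝ) ≤ τ := Real.sqrt_le_iff.2 ⟨hτ, hv⟩
  calc mgf (fun w ↦ |c + g w|) μ t
      ≤ ∫ w, Real.exp (t * |c|) * Real.exp (t * |g w|) ∂μ := by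
        refine integral_mono_of_nonneg (.of_forall fun w ↦ by positivity) (hint.const_mul _)
          (.of_forall fun w ↦ ?_)
        simp only
        rw [← Real.exp_add, ← mul_add]
        gcongr
        exact abs_add_le _ _
    _ ≤ Real.exp (t * |c|) * Real.exp (t * (√(2 / Real.pi) * √v) + t ^ 2 * v / 2) := by
        rw [integral_const_mul, hlaw]
        gcongr
        exact integral_exp_mul_abs_gaussianReal_le v ht
    _ ≤ _ := by
        rw [← Real.exp_add, mul_add, add_assoc]
        gcongr

/-- Convexity gives `|c| + sign c * g ≤ |c + g|`, so the lower tail of `|c + g|` about `|c|` is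
dominated by that of a Gaussian. -/
lemma mgf_neg_abs_const_add_le {Ω : Type*} [MeasurableSpace Ω] {μ : Measure Ω}
    [IsProbabilityMeasure μ] {g : Ω → ℝ} {v : ℝ≥0} (hg : HasLaw g (gaussianReal 0 v) μ)
    (c : ℝ) {τ : ℝ} (hv : (v : ℝ) ≤ τ ^ 2) {t : ℝ} (ht : 0 ≤ t) :
    mgf (fun w ↦ -|c + g w|) μ t ≤ Real.exp (t * (-|c|) + t ^ 2 * τ ^ 2 / 2) := by
  obtain ⟨r, hr, hrc⟩ : ∃ r : ℝ, r ^ 2 = 1 ∧ |c| = r * c := by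
    rcases abs_cases c with ⟨h, _⟩ | ⟨h, _⟩
    · exact ⟨1, by norm_num, by simp [h]⟩
    · exact ⟨-1, by norm_num, by simp [h]⟩
  have hint : Integrable (fun w ↦ Real.exp (-t * r * g w)) μ := by
    have h := integrable_exp_mul_gaussianReal (μ := 0) (v := v) (-t * r)
    rw [← hg.map_eq] at h
    exact h.comp_aemeasurable hg.aemeasurable
  have hr1 : |r| = 1 := by rw [← sq_eq_sq₀ (abs_nonneg r) zero_le_one, sq_abs, hr, one_pow]
  calc mgf (fun w ↦ -|c + g w|) μ t
      ≤ ∫ w, Real.exp (t * (-|c|)) * Real.exp (-t * r * g w) ∂μ := by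
        refine integral_mono_of_nonneg (.of_forall fun w ↦ by positivity) (hint.const_mul _)
          (.of_forall fun w ↦ ?_)
        simp only
        rw [← Real.exp_add, Real.exp_le_exp]
        have h : r * (c + g w) ≤ |c + g w| := by
          rw [← one_mul |c + g w|, ← hr1, ← abs_mul]; exact le_abs_self _
        rw [hrc]
        nlinarith
    _ = Real.exp (t * (-|c|)) * Real.exp (t ^ 2 * v / 2) := by
        rw [integral_const_mul]
        congr 1
        have := mgf_gaussianReal hg.map_eq (-t * r)
        rw [mgf] at this
        rw [this]
        congr 1
        linear_combination (v * t ^ 2 / 2 : ℝ) * hr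
    _ ≤ _ := by
        rw [← Real.exp_add]
        gcongr

lemma integrable_exp_mul_abs_const_add {Ω : Type*} [MeasurableSpace Ω] {μ : Measure Ω}
    [IsProbabilityMeasure μ] {g : Ω → ℝ} {v : ℝ≥0} (hg : HasLaw g (gaussianReal 0 v) μ)
    (c t : ℝ) : Integrable (fun w ↦ Real.exp (t * |c + g w|)) μ := by
  have hm := hg.aemeasurable
  have hint : Integrable (fun w ↦ Real.exp (|t| * |g w|)) μ := by
    have h := integrable_exp_mul_abs_gaussianReal v |t|
    rw [← hg.map_eq] at h
    exact h.comp_aemeasurable hg.aemeasurable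
  refine (hint.const_mul (Real.exp (|t| * |c|))).mono'
    (AEMeasurable.aestronglyMeasurable (by fun_prop)) (.of_forall fun w ↦ ?_)
  rw [Real.norm_of_nonneg (by positivity), ← Real.exp_add, ← mul_add]
  gcongr
  · exact le_abs_self t
  · exact abs_add_le _ _

lemma hasLaw_inner_gaussian {Ω : Type*} [MeasurableSpace Ω] {μ : Measure Ω} {m : ℕ}
    {τ : ℝ} {g : Ω → EuclideanSpace ℝ (Fin m)}
    (hg : HasLaw g (multivariateGaussian 0 (τ ^ 2 • (1 : Matrix (Fin m) (Fin m) ℝ))) μ)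
    (u : EuclideanSpace ℝ (Fin m)) :
    HasLaw (fun w ↦ ⟪u, g w⟫) (gaussianReal 0 (τ ^ 2 * ‖u‖ ^ 2).toNNReal) μ := by
  have hS : (τ ^ 2 • (1 : Matrix (Fin m) (Fin m) ℝ)).PosSemidef :=
    Matrix.PosSemidef.one.smul (sq_nonneg τ)
  refine HasLaw.fun_comp (X := g) (Y := fun x ↦ ⟪u, x⟫) ⟨by fun_prop, ?_⟩ hg
  have h := IsGaussian.map_eq_gaussianReal
    (μ := multivariateGaussian 0 (τ ^ 2 • (1 : Matrix (Fin m) (Fin m) ℝ))) (innerSL ℝ u)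
  have h1 : Var[innerSL ℝ u; multivariateGaussian 0 (τ ^ 2 • (1 : Matrix (Fin m) (Fin m) ℝ))] =
      τ ^ 2 * ‖u‖ ^ 2 := by
    have := covarianceBilin_self (IsGaussian.memLp_two_id
      (μ := multivariateGaussian 0 (τ ^ 2 • (1 : Matrix (Fin m) (Fin m) ℝ)))) u
    rw [covarianceBilin_multivariateGaussian hS] at this
    rw [show (innerSL ℝ u : EuclideanSpace ℝ (Fin m) → ℝ) = fun x ↦ ⟪u, x⟫ from rfl, ← this,
      EuclideanSpace.real_norm_sq_eq]
    simp only [Matrix.smul_mulVec, Matrix.one_mulVec, dotProduct_smul, smul_eq_mul]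
    simp [dotProduct, sq]
  have h2 : (multivariateGaussian 0 (τ ^ 2 • (1 : Matrix (Fin m) (Fin m) ℝ)))[innerSL ℝ u] = 0 := by
    rw [ContinuousLinearMap.integral_comp_id_comm IsGaussian.integrable_id]
    simp
  rw [h1, h2] at h
  exact h

/-! ### Restricted isometries -/

section RestrictedIsometry

variable {V W : Type*} [NormedAddCommGroup V] [InnerProductSpace ℝ V]
  [NormedAddCommGroup W] [InnerProductSpace ℝ W]

/-- Polarization: for an almost isometry `A`, the operator norm of the self-adjoint map `A† A - 1`
is controlled by its quadratic form. -/
lemma norm_sub_le_of_almost_isometry (A : V →ₗ[ℝ] W) {δ : ℝ}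
    (hA : ∀ u, (1 - δ) * ‖u‖ ^ 2 ≤ ‖A u‖ ^ 2 ∧ ‖A u‖ ^ 2 ≤ (1 + δ) * ‖u‖ ^ 2) (hδ : 0 ≤ δ)
    {w e : V} (hw : ∀ u, ⟪A w, A u⟫ = ⟪e, u⟫) : ‖e - w‖ ≤ δ * ‖w‖ := by
  set z := e - w with hz
  have key : ∀ c : ℝ, 0 ≤ (δ / 2 * ‖z‖ ^ 2) * (c * c) + (-‖z‖ ^ 2) * c + δ / 2 * ‖w‖ ^ 2 := by
    intro c
    have h1 := (hA (w + c • z)).2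
    have h2 := (hA (w - c • z)).1
    have h3 : ⟪e, c • z⟫ - ⟪w, c • z⟫ = c * ‖z‖ ^ 2 := by
      rw [← inner_sub_left, ← hz, real_inner_smul_right, real_inner_self_eq_norm_sq]
    rw [map_add, norm_add_sq_real, norm_add_sq_real, hw, norm_smul, mul_pow, Real.norm_eq_abs,
      sq_abs] at h1
    rw [map_sub, norm_sub_sq_real, norm_sub_sq_real, hw, norm_smul, mul_pow, Real.norm_eq_abs,
      sq_abs] at h2
    nlinarith
  have h := discrim_le_zero key
  rw [discrim] at h
  rcases (norm_nonneg z).eq_or_lt with h0 | h0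
  · rw [← h0]; positivity
  · have h1 : ‖z‖ ^ 2 * (‖z‖ ^ 2 - (δ * ‖w‖) ^ 2) ≤ 0 := by linarith
    have h2 : ‖z‖ ^ 2 - (δ * ‖w‖) ^ 2 ≤ 0 := nonpos_of_mul_nonpos_right h1 (by positivity)
    exact (sq_le_sq₀ h0.le (by positivity)).1 (by linarith)

/-- The inverse of the Gram operator `A† A` of an almost isometry lies within `δ / (1 - δ²)` of
`1 / (1 - δ²)`, the midpoint of the interval `[1 / (1 + δ), 1 / (1 - δ)]` that holds its
spectrum. -/
lemma exists_gram_inverse_apply [FiniteDimensional ℝ V] [FiniteDimensional ℝ W] (A : V →ₗ[ℝ] W)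
    {δ : ℝ} (hA : ∀ u, (1 - δ) * ‖u‖ ^ 2 ≤ ‖A u‖ ^ 2 ∧ ‖A u‖ ^ 2 ≤ (1 + δ) * ‖u‖ ^ 2)
    (hδ : 0 ≤ δ) (hδ1 : δ < 1) (e : V) :
    ∃ w, (∀ u, ⟪A w, A u⟫ = ⟪e, u⟫) ∧ ‖(1 - δ ^ 2) • w - e‖ ≤ δ * ‖e‖ := by
  have hinj : Function.Injective (A.adjoint ∘ₗ A) := by
    rw [injective_iff_map_eq_zero]
    intro u hu
    have h1 : ‖A u‖ ^ 2 = 0 := by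
      rw [← real_inner_self_eq_norm_sq, ← LinearMap.adjoint_inner_left, ← LinearMap.comp_apply, hu,
        inner_zero_left]
    have h2 := (hA u).1
    have h3 : ‖u‖ ^ 2 ≤ 0 := by
      by_contra! h
      nlinarith
    simpa using h3.antisymm (sq_nonneg _)
  obtain ⟨w, hw⟩ := LinearMap.surjective_of_injective hinj e
  have hw' : ∀ u, ⟪A w, A u⟫ = ⟪e, u⟫ := fun u ↦ by
    rw [← LinearMap.adjoint_inner_left, ← LinearMap.comp_apply, hw]
  refine ⟨w, hw', ?_⟩
  have h := norm_sub_le_of_almost_isometry A hA hδ hw'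
  have h2 : ‖e - w‖ ^ 2 ≤ (δ * ‖w‖) ^ 2 := by gcongr
  rw [norm_sub_sq_real] at h2
  refine (sq_le_sq₀ (norm_nonneg _) (by positivity)).1 ?_
  have h3 : 0 < 1 - δ ^ 2 := by nlinarith
  rw [norm_sub_sq_real, norm_smul, real_inner_smul_left, real_inner_comm, mul_pow, Real.norm_eq_abs,
    sq_abs]
  nlinarith

end RestrictedIsometry

variable {m n : ℕ}

lemma toLp_mulVec_eq_sum (Φ : Matrix (Fin m) (Fin n) ℝ) (u : Fin n → ℝ) :
    (WithLp.toLp 2 (Φ.mulVec u) : EuclideanSpace ℝ (Fin m)) = ∑ j, u j • atom Φ j := by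
  ext i
  simp [atom, Matrix.mulVec, dotProduct, mul_comm]

open Classical in
lemma ric_spec (Φ : Matrix (Fin m) (Fin n) ℝ) (r : ℕ) (u : EuclideanSpace ℝ (Fin n))
    (hu : (Finset.univ.filter fun j => u j ≠ 0).card ≤ r) :
    (1 - ric Φ r) * ‖u‖ ^ 2 ≤
        ‖(WithLp.toLp 2 (Φ.mulVec u.ofLp) : EuclideanSpace ℝ (Fin m))‖ ^ 2 ∧
      ‖(WithLp.toLp 2 (Φ.mulVec u.ofLp) : EuclideanSpace ℝ (Fin m))‖ ^ 2 ≤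
        (1 + ric Φ r) * ‖u‖ ^ 2 := by
  rcases (norm_nonneg u).eq_or_lt with h0 | h0
  · have : u = 0 := norm_eq_zero.1 h0.symm
    subst this
    simp
  have h0' : 0 < ‖u‖ ^ 2 := by positivity
  set y := (WithLp.toLp 2 (Φ.mulVec u.ofLp) : EuclideanSpace ℝ (Fin m)) with hy
  have hne : {δ : ℝ | ∀ u : EuclideanSpace ℝ (Fin n),
      (Finset.univ.filter fun j => u j ≠ 0).card ≤ r →
      (1 - δ) * ‖u‖ ^ 2 ≤ ‖(WithLp.toLp 2 (Φ.mulVec u.ofLp) : EuclideanSpace ℝ (Fin m))‖ ^ 2 ∧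
      ‖(WithLp.toLp 2 (Φ.mulVec u.ofLp) : EuclideanSpace ℝ (Fin m))‖ ^ 2 ≤
        (1 + δ) * ‖u‖ ^ 2}.Nonempty := by
    set A := (Matrix.toEuclideanLin Φ).toContinuousLinearMap with hA
    refine ⟨1 + ‖A‖ ^ 2, fun x _ ↦ ⟨?_, ?_⟩⟩
    · refine le_trans ?_ (sq_nonneg _)
      nlinarith [mul_nonneg (sq_nonneg ‖A‖) (sq_nonneg ‖x‖)]
    · have h1 : (WithLp.toLp 2 (Φ.mulVec x.ofLp) : EuclideanSpace ℝ (Fin m)) = A x := by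
        simp [hA, Matrix.toLpLin_apply]
      have h2 := A.le_opNorm x
      rw [h1]
      calc ‖A x‖ ^ 2 ≤ (‖A‖ * ‖x‖) ^ 2 := by gcongr
        _ ≤ _ := by nlinarith [sq_nonneg ‖x‖]
  constructor
  · have : 1 - ‖y‖ ^ 2 / ‖u‖ ^ 2 ≤ ric Φ r := by
      refine le_csInf hne fun δ hδ ↦ ?_
      have := (hδ u hu).1
      rw [sub_le_comm, le_div_iff₀ h0']
      exact this
    rwa [sub_le_comm, le_div_iff₀ h0'] at this
  · have : ‖y‖ ^ 2 / ‖u‖ ^ 2 - 1 ≤ ric Φ r := by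
      refine le_csInf hne fun δ hδ ↦ ?_
      have := (hδ u hu).2
      rw [sub_le_iff_le_add', div_le_iff₀ h0']
      exact this
    rwa [sub_le_iff_le_add', div_le_iff₀ h0'] at this

lemma ric_nonneg (Φ : Matrix (Fin m) (Fin n) ℝ) (hΦ : ∀ j, ‖atom Φ j‖ = 1) (j : Fin n) {r : ℕ}
    (hr : 1 ≤ r) : 0 ≤ ric Φ r := by
  classical
  have h := (ric_spec Φ r (EuclideanSpace.single j 1) (by
    refine le_trans (le_of_eq ?_) hr
    rw [Finset.card_eq_one]
    exact ⟨j, by ext i; simp⟩)).2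
  rw [toLp_mulVec_eq_sum] at h
  simp [hΦ] at h
  exact h

/-- The Euclidean vectors supported on `S`. -/
def supportedOn (S : Finset (Fin n)) : Submodule ℝ (EuclideanSpace ℝ (Fin n)) where
  carrier := {u | ∀ j ∉ S, u j = 0}
  add_mem' hu hv j hj := by simp [hu j hj, hv j hj]
  zero_mem' j _ := rfl
  smul_mem' c u hu j hj := by simp [hu j hj]

lemma card_filter_ne_zero_le {S : Finset (Fin n)} {u : EuclideanSpace ℝ (Fin n)}
    (hu : u ∈ supportedOn S) [DecidablePred fun j ↦ u j ≠ 0] :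
    (Finset.univ.filter fun j => u j ≠ 0).card ≤ S.card :=
  Finset.card_le_card fun j hj ↦ by
    by_contra h
    exact (Finset.mem_filter.1 hj).2 (hu j h)

lemma inner_proj_eq_zero (Φ : Matrix (Fin m) (Fin n) ℝ) (T : Finset (Fin n))
    {z : EuclideanSpace ℝ (Fin m)} (hz : ∀ i ∈ T, ⟪z, atom Φ i⟫ = 0)
    (y : EuclideanSpace ℝ (Fin m)) : ⟪z, proj Φ T y⟫ = 0 := by
  have h : z ∈ (Submodule.span ℝ (atom Φ '' (T : Set (Fin n))))ᗮ := by
    rw [Submodule.mem_orthogonal']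
    intro x hx
    induction hx using Submodule.span_induction with
    | mem x hx => obtain ⟨i, hi, rfl⟩ := hx; exact hz i hi
    | zero => exact inner_zero_right _
    | add x y _ _ h1 h2 => rw [inner_add_right, h1, h2, add_zero]
    | smul c x _ h1 => rw [real_inner_smul_right, h1, mul_zero]
  exact (Submodule.mem_orthogonal' _ _).1 h _ (Submodule.starProjection_apply_mem _ _)

/-- Under the restricted isometry property on `S`, each coordinate in `S` of a vector supported
on `S` is a combination of the atoms' correlations with the measurement, with coefficients of small
`ℓ¹` norm (a row of the inverse Gram matrix). The residual may replace the measurement as long as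
the coordinate has not been projected out: the combination of atoms is then orthogonal to those
in `T`. -/
lemma exists_dual_coefficients (Φ : Matrix (Fin m) (Fin n) ℝ) (hΦ : ∀ j, ‖atom Φ j‖ = 1)
    (S T : Finset (Fin n)) (hδ1 : ric Φ S.card < 1) {i : Fin n} (hi : i ∈ S) (hiT : i ∉ T)
    (hTS : T ⊆ S) :
    ∃ c : Fin n → ℝ,
      (1 - ric Φ S.card) * (1 + ric Φ S.card) * ∑ j ∈ S, |c j| ≤ 1 + √S.card * ric Φ S.card ∧
      ∀ x : Fin n → ℝ, (∀ j ∉ S, x j = 0) →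
        x i = ∑ j ∈ S, c j * ⟪atom Φ j, WithLp.toLp 2 (Φ.mulVec x) -
          proj Φ T (WithLp.toLp 2 (Φ.mulVec x))⟫ := by
  classical
  set δ := ric Φ S.card
  have hδ : 0 ≤ δ := ric_nonneg Φ hΦ i (Finset.card_pos.2 ⟨i, hi⟩)
  set A : supportedOn S →ₗ[ℝ] EuclideanSpace ℝ (Fin m) :=
    Matrix.toEuclideanLin Φ ∘ₗ (supportedOn S).subtype with hAdef
  have hA : ∀ u, A u = WithLp.toLp 2 (Φ.mulVec u.1.ofLp) := fun u ↦ by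
    simp [hAdef, Matrix.toLpLin_apply]
  have hsingle : ∀ j ∈ S, EuclideanSpace.single j (1 : ℝ) ∈ supportedOn S := by
    intro j hj l hl
    have : l ≠ j := by rintro rfl; exact hl hj
    simp [this]
  obtain ⟨w, hw, hnorm⟩ := exists_gram_inverse_apply A (δ := δ) (fun u ↦ by
    rw [hA]; exact ric_spec Φ _ u.1 (card_filter_ne_zero_le u.2)) hδ hδ1
    ⟨EuclideanSpace.single i 1, hsingle i hi⟩
  have hAw : A w = ∑ j ∈ S, w.1 j • atom Φ j := by
    rw [hA, toLp_mulVec_eq_sum]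
    exact (Finset.sum_subset (Finset.subset_univ S) fun j _ hj ↦ by rw [w.2 j hj, zero_smul]).symm
  refine ⟨fun j ↦ w.1 j, ?_, fun x hx ↦ ?_⟩
  · set d : EuclideanSpace ℝ (Fin n) := (1 - δ ^ 2) • w.1 - EuclideanSpace.single i 1 with hd
    have hdn : ‖d‖ ≤ δ := by
      have : ‖d‖ = ‖(1 - δ ^ 2) • w - ⟨EuclideanSpace.single i 1, hsingle i hi⟩‖ := rfl
      rw [this]
      refine hnorm.trans (le_of_eq ?_)
      simp
    have h3 : 0 < 1 - δ ^ 2 := by nlinarith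
    have hsum : ∑ j ∈ S, |d j| ≤ √S.card * δ := by
      have h1 : (∑ j ∈ S, |d j|) ^ 2 ≤ S.card * ∑ j ∈ S, |d j| ^ 2 := sq_sum_le_card_mul_sum_sq
      have h2 : ∑ j ∈ S, |d j| ^ 2 ≤ ‖d‖ ^ 2 := by
        rw [EuclideanSpace.real_norm_sq_eq]
        simp only [sq_abs]
        exact Finset.sum_le_univ_sum_of_nonneg fun _ ↦ sq_nonneg _
      refine Real.le_sqrt_of_sq_le (h1.trans (mul_le_mul_of_nonneg_left h2 (by positivity)))
        |>.trans ?_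
      rw [Real.sqrt_mul (by positivity), Real.sqrt_sq (norm_nonneg _)]
      gcongr
    calc (1 - δ) * (1 + δ) * ∑ j ∈ S, |w.1 j| = ∑ j ∈ S, |(1 - δ ^ 2) * w.1 j| := by
          rw [Finset.mul_sum]
          refine Finset.sum_congr rfl fun j _ ↦ ?_
          rw [abs_mul, abs_of_pos h3]
          ring
      _ ≤ ∑ j ∈ S, ((if j = i then 1 else 0) + |d j|) := by
          refine Finset.sum_le_sum fun j _ ↦ ?_
          have : (1 - δ ^ 2) * w.1 j = (if j = i then 1 else 0) + d j := by
            simp [hd]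
          rw [this]
          refine (abs_add_le _ _).trans (le_of_eq ?_)
          split_ifs <;> simp
      _ ≤ 1 + √S.card * δ := by
          rw [Finset.sum_add_distrib, Finset.sum_ite_eq' S i, if_pos hi]
          gcongr
  · have hxs : (WithLp.toLp 2 x : EuclideanSpace ℝ (Fin n)) ∈ supportedOn S := hx
    have h1 := hw ⟨WithLp.toLp 2 x, hxs⟩
    have h2 : ⟪A w, proj Φ T (WithLp.toLp 2 (Φ.mulVec x))⟫ = 0 := by
      refine inner_proj_eq_zero Φ T (fun l hl ↦ ?_) _
      have h := hw ⟨EuclideanSpace.single l 1, hsingle l (hTS hl)⟩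
      have hil : i ≠ l := by rintro rfl; exact hiT hl
      have h3 : A ⟨EuclideanSpace.single l 1, hsingle l (hTS hl)⟩ = atom Φ l := by
        rw [hA, toLp_mulVec_eq_sum]
        simp
      rw [h3] at h
      rw [h]
      simp [EuclideanSpace.inner_single_left, hil]
    rw [hA ⟨WithLp.toLp 2 x, hxs⟩] at h1
    have h4 : ⟪A w, WithLp.toLp 2 (Φ.mulVec x) - proj Φ T (WithLp.toLp 2 (Φ.mulVec x))⟫ = x i := by
      rw [inner_sub_right, h2, h1]
      simp [EuclideanSpace.inner_single_left]
    rw [← h4, hAw, sum_inner]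
    simp only [real_inner_smul_left]

/-! ### The noiseless metric of the correct atoms -/

lemma metric_le_gammaC (Φ : Matrix (Fin m) (Fin n) ℝ) (X : Matrix (Fin n) ℕ ℝ) (K : ℕ)
    (T : Finset (Fin n)) {j : Fin n} (hj : j ∈ jointSupport X) :
    metric Φ (residual Φ T (cleanMeas Φ X K)) j ≤ gammaC Φ X K T :=
  le_ciSup (f := fun j : {j : Fin n // j ∈ jointSupport X} ↦
    metric Φ (residual Φ T (cleanMeas Φ X K)) j) (Set.finite_range _).bddAbove ⟨j, hj⟩

lemma eq_zero_of_notMem_jointSupport {X : Matrix (Fin n) ℕ ℝ} {j : Fin n}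
    (hj : j ∉ jointSupport X) (k : ℕ) : X j k = 0 := by
  by_contra h
  exact hj (by simpa [jointSupport] using ⟨k, h⟩)

lemma correctMetricBound_psiRIC (Φ : Matrix (Fin m) (Fin n) ℝ) (hΦ : ∀ j, ‖atom Φ j‖ = 1)
    (X : Matrix (Fin n) ℕ ℝ) {s : ℕ} (hs : s < (jointSupport X).card)
    (hδ1 : ric Φ (jointSupport X).card < 1) (K : ℕ) :
    CorrectMetricBound Φ X s (psiRIC Φ (jointSupport X).card) K := by
  intro t ht T hT
  obtain ⟨hTS, hTc⟩ := Finset.mem_powersetCard.1 hT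
  set S := jointSupport X with hS
  obtain ⟨i, hi, hiT⟩ : ∃ i ∈ S, i ∉ T :=
    Finset.exists_mem_notMem_of_card_lt_card (by omega)
  obtain ⟨c, hc, hrep⟩ := exists_dual_coefficients Φ hΦ S T hδ1 hi hiT hTS
  have hδ : 0 ≤ ric Φ S.card := ric_nonneg Φ hΦ i (Finset.card_pos.2 ⟨i, hi⟩)
  have hγ : 0 ≤ gammaC Φ X K T :=
    le_trans (Finset.sum_nonneg fun _ _ ↦ abs_nonneg _) (metric_le_gammaC Φ X K T hi)
  have h1 : ∑ k ∈ Finset.range K, |X i k| ≤ (∑ j ∈ S, |c j|) * gammaC Φ X K T := by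
    rw [Finset.sum_range, Finset.sum_mul]
    calc ∑ k : Fin K, |X i k|
        ≤ ∑ k : Fin K, ∑ j ∈ S, |c j| * |⟪atom Φ j, residual Φ T (cleanMeas Φ X K) k⟫| := by
          refine Finset.sum_le_sum fun k _ ↦ ?_
          rw [hrep (fun j ↦ X j k) fun j hj ↦ eq_zero_of_notMem_jointSupport hj k]
          refine (Finset.abs_sum_le_sum_abs _ _).trans (le_of_eq ?_)
          simp only [abs_mul]
          rfl
      _ = ∑ j ∈ S, |c j| * metric Φ (residual Φ T (cleanMeas Φ X K)) j := by
          rw [Finset.sum_comm]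
          simp only [metric, Finset.mul_sum]
      _ ≤ _ := by
          gcongr with j hj
          exact metric_le_gammaC Φ X K T hj
  have h2 : tauX X K ≤ ∑ k ∈ Finset.range K, |X i k| :=
    ciInf_le (f := fun j : {j : Fin n // j ∈ jointSupport X} ↦ ∑ k ∈ Finset.range K, |X j k|)
      (Set.finite_range _).bddBelow ⟨i, hi⟩
  have hp : 0 ≤ (1 - ric Φ S.card) * (1 + ric Φ S.card) :=
    mul_nonneg (by linarith) (by linarith)
  rw [psiRIC, div_mul_eq_mul_div, div_le_iff₀ (by positivity)]
  calc (1 - ric Φ S.card) * (1 + ric Φ S.card) * tauX X K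
      ≤ (1 - ric Φ S.card) * (1 + ric Φ S.card) * ((∑ j ∈ S, |c j|) * gammaC Φ X K T) := by
        gcongr
        exact h2.trans h1
    _ ≤ (1 + √S.card * ric Φ S.card) * gammaC Φ X K T := by
        rw [← mul_assoc]
        gcongr
    _ = _ := mul_comm _ _

/-! ### Signal-to-noise quantities -/

lemma muX_eq (X : Matrix (Fin n) ℕ ℝ) (K : ℕ) : muX X K = 1 / (K : ℝ) * tauX X K := by
  rw [muX, tauX, Real.mul_iInf_of_nonneg (by positivity)]

lemma snrMin_le (X : Matrix (Fin n) ℕ ℝ) (σ : ℕ → ℝ) {K : ℕ} (hK : 1 ≤ K) :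
    snrMin X σ ≤ muX X K / sigmaAvg σ K :=
  ciInf_le (f := fun K : ℕ+ ↦ muX X K / sigmaAvg σ K) ⟨0, by
    rintro _ ⟨K, rfl⟩
    exact div_nonneg (Real.iInf_nonneg fun j ↦ by positivity) (Real.sqrt_nonneg _)⟩ ⟨K, hK⟩

lemma snrMin_nonneg (X : Matrix (Fin n) ℕ ℝ) (σ : ℕ → ℝ) : 0 ≤ snrMin X σ :=
  Real.iInf_nonneg fun _ ↦
    div_nonneg (Real.iInf_nonneg fun j ↦ by positivity) (Real.sqrt_nonneg _)

lemma le_omegaSigma (σ : ℕ → ℝ) {K : ℕ} (hK : 1 ≤ K) :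
    (1 / √(K : ℝ)) * ((∑ k ∈ Finset.range K, |σ k|) / √(∑ k ∈ Finset.range K, σ k ^ 2)) ≤
      omegaSigma σ := by
  refine le_ciSup (f := fun K : ℕ+ ↦ (1 / √((K : ℕ) : ℝ)) *
    ((∑ k ∈ Finset.range K, |σ k|) / √(∑ k ∈ Finset.range K, σ k ^ 2))) ⟨1, ?_⟩ ⟨K, hK⟩
  rintro _ ⟨K, rfl⟩
  have h1 : (∑ k ∈ Finset.range K, |σ k|) ^ 2 ≤ K * ∑ k ∈ Finset.range K, |σ k| ^ 2 := by
    simpa using sq_sum_le_card_mul_sum_sq (s := Finset.range K) (f := fun k ↦ |σ k|)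
  simp only [sq_abs] at h1
  have h2 := Real.le_sqrt_of_sq_le h1
  rw [Real.sqrt_mul (by positivity)] at h2
  simp only
  rw [div_mul_div_comm, one_mul]
  exact div_le_one_of_le₀ h2 (by positivity)

lemma omegaSigma_nonneg (σ : ℕ → ℝ) : 0 ≤ omegaSigma σ :=
  Real.iSup_nonneg fun _ ↦ by positivity

lemma sum_range_sq_pos {σ : ℕ → ℝ} (hσ₀ : 0 < σ 0) {K : ℕ} (hK : 1 ≤ K) :
    0 < ∑ k ∈ Finset.range K, σ k ^ 2 :=
  Finset.sum_pos' (fun _ _ ↦ sq_nonneg _) ⟨0, Finset.mem_range.2 hK, by positivity⟩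

lemma mul_snrMin_le_tauX (X : Matrix (Fin n) ℕ ℝ) {σ : ℕ → ℝ} (hσ₀ : 0 < σ 0) {K : ℕ}
    (hK : 1 ≤ K) : √(K * ∑ k ∈ Finset.range K, σ k ^ 2) * snrMin X σ ≤ tauX X K := by
  have hK0 : (0 : ℝ) < K := by exact_mod_cast hK
  have hV := sum_range_sq_pos hσ₀ hK
  have h := snrMin_le X σ hK
  have hpos : 0 < sigmaAvg σ K := Real.sqrt_pos.2 (by positivity)
  rw [le_div_iff₀ hpos, muX_eq, one_div, inv_mul_eq_div, le_div_iff₀ hK0] at h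
  have : √(K * ∑ k ∈ Finset.range K, σ k ^ 2) = sigmaAvg σ K * K := by
    rw [sigmaAvg, Real.sqrt_eq_iff_mul_self_eq (by positivity) (by positivity)]
    have := Real.mul_self_sqrt (show 0 ≤ 1 / (K : ℝ) * ∑ k ∈ Finset.range K, σ k ^ 2 by positivity)
    rw [mul_mul_mul_comm, this]
    field_simp
  rw [this]
  linarith

lemma sum_le_mul_omegaSigma {σ : ℕ → ℝ} (hσ : ∀ k, 0 ≤ σ k) (hσ₀ : 0 < σ 0) {K : ℕ}
    (hK : 1 ≤ K) :
    ∑ k ∈ Finset.range K, σ k ≤ √(K * ∑ k ∈ Finset.range K, σ k ^ 2) * omegaSigma σ := by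
  have hK0 : (0 : ℝ) < K := by exact_mod_cast hK
  have hV := sum_range_sq_pos hσ₀ hK
  have h := le_omegaSigma σ hK
  simp only [abs_of_nonneg (hσ _)] at h
  rw [div_mul_div_comm, one_mul, ← Real.sqrt_mul hK0.le, div_le_iff₀ (by positivity)] at h
  linarith

/-- The margin by which the noiseless metric of the best correct atom beats that of the incorrect
ones and the mean modulus of the noise. -/
lemma xi_mul_le_gammaC_sub (Φ : Matrix (Fin m) (Fin n) ℝ) (X : Matrix (Fin n) ℕ ℝ) {σ : ℕ → ℝ}
    (hσ : ∀ k, 0 ≤ σ k) (hσ₀ : 0 < σ 0) {Γ ψ : ℝ} (hΓ : 1 < Γ) (hξ : 0 < xi X σ Γ ψ)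
    {K : ℕ} (hK : 1 ≤ K) {T : Finset (Fin n)} (h1 : Γ * gammaI Φ X K T ≤ gammaC Φ X K T)
    (h2 : ψ * tauX X K ≤ gammaC Φ X K T) :
    √(K * ∑ k ∈ Finset.range K, σ k ^ 2) * xi X σ Γ ψ ≤
      gammaC Φ X K T - gammaI Φ X K T - √(2 / Real.pi) * ∑ k ∈ Finset.range K, σ k := by
  have hτ := mul_snrMin_le_tauX X hσ₀ hK
  have hω := sum_le_mul_omegaSigma hσ hσ₀ hK
  set D := √(K * ∑ k ∈ Finset.range K, σ k ^ 2)
  have hΓ' : 0 < 1 - 1 / Γ := by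
    rw [sub_pos, div_lt_one (by linarith)]
    exact hΓ
  -- Only a positive `ψ` makes `ξ` positive, since the other factors are nonnegative.
  have hψ : 0 ≤ ψ := by
    by_contra! h
    have h3 : (1 - 1 / Γ) * ψ * snrMin X σ ≤ 0 :=
      mul_nonpos_of_nonpos_of_nonneg (mul_nonpos_of_nonneg_of_nonpos hΓ'.le h.le)
        (snrMin_nonneg X σ)
    have h4 : 0 ≤ √(2 / Real.pi) * omegaSigma σ :=
      mul_nonneg (Real.sqrt_nonneg _) (omegaSigma_nonneg σ)
    rw [xi] at hξ
    linarith
  have h3 : (1 - 1 / Γ) * gammaC Φ X K T ≤ gammaC Φ X K T - gammaI Φ X K T := by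
    have : gammaI Φ X K T ≤ 1 / Γ * gammaC Φ X K T := by
      rw [one_div, inv_mul_eq_div, le_div_iff₀ (by linarith)]
      linarith
    linarith
  have h4 : (1 - 1 / Γ) * (ψ * (D * snrMin X σ)) ≤ (1 - 1 / Γ) * gammaC Φ X K T := by
    gcongr
    exact (mul_le_mul_of_nonneg_left hτ hψ).trans h2
  have h5 : √(2 / Real.pi) * ∑ k ∈ Finset.range K, σ k ≤ √(2 / Real.pi) * (D * omegaSigma σ) := by
    gcongr
  rw [xi]
  linarith

/-! ### The first wrong decision -/

/-- The component `(I - P_T) φ_j` of an atom, so that its inner product with a vector is the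
correlation of the atom with the residual of this vector. -/
noncomputable def residualAtom (Φ : Matrix (Fin m) (Fin n) ℝ) (T : Finset (Fin n)) (j : Fin n) :
    EuclideanSpace ℝ (Fin m) :=
  atom Φ j - proj Φ T (atom Φ j)

lemma inner_atom_sub_proj (Φ : Matrix (Fin m) (Fin n) ℝ) (T : Finset (Fin n)) (j : Fin n)
    (y : EuclideanSpace ℝ (Fin m)) :
    ⟪atom Φ j, y - proj Φ T y⟫ = ⟪residualAtom Φ T j, y⟫ := by
  rw [residualAtom, inner_sub_right, inner_sub_left, proj,
    Submodule.inner_starProjection_left_eq_right]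

lemma norm_residualAtom_le (Φ : Matrix (Fin m) (Fin n) ℝ) (T : Finset (Fin n)) {j : Fin n}
    (hj : ‖atom Φ j‖ = 1) : ‖residualAtom Φ T j‖ ≤ 1 := by
  have h := inner_atom_sub_proj Φ T j (residualAtom Φ T j)
  have h0 : proj Φ T (residualAtom Φ T j) = 0 := by
    rw [residualAtom, map_sub, sub_eq_zero]
    exact (Submodule.starProjection_eq_self_iff.2 (Submodule.starProjection_apply_mem _ _)).symm
  rw [h0, sub_zero, real_inner_self_eq_norm_sq] at h
  have h1 := real_inner_le_norm (atom Φ j) (residualAtom Φ T j)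
  rw [h, hj, one_mul] at h1
  by_contra! h2
  nlinarith

lemma metric_noisyMeas (Φ : Matrix (Fin m) (Fin n) ℝ) (X : Matrix (Fin n) ℕ ℝ)
    (e : ℕ → EuclideanSpace ℝ (Fin m)) (K : ℕ) (T : Finset (Fin n)) (j : Fin n) :
    metric Φ (residual Φ T (noisyMeas Φ X e K)) j =
      ∑ k ∈ Finset.range K, |⟪residualAtom Φ T j, WithLp.toLp 2 (Φ.mulVec fun j => X j k)⟫ +
        ⟪residualAtom Φ T j, e k⟫| := by
  rw [Finset.sum_range, metric]
  refine Finset.sum_congr rfl fun k _ ↦ ?_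
  rw [residual, inner_atom_sub_proj, noisyMeas, inner_add_right]
  rfl

lemma metric_cleanMeas (Φ : Matrix (Fin m) (Fin n) ℝ) (X : Matrix (Fin n) ℕ ℝ)
    (K : ℕ) (T : Finset (Fin n)) (j : Fin n) :
    metric Φ (residual Φ T (cleanMeas Φ X K)) j =
      ∑ k ∈ Finset.range K, |⟪residualAtom Φ T j, WithLp.toLp 2 (Φ.mulVec fun j => X j k)⟫| := by
  rw [Finset.sum_range, metric]
  refine Finset.sum_congr rfl fun k _ ↦ ?_
  rw [residual, inner_atom_sub_proj]
  rfl

/-- At the first wrong iteration the estimated support is a subset `T` of the true one, and an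
incorrect atom is at least as good as every atom. -/
lemma Errs.exists_first {K : ℕ} {Φ : Matrix (Fin m) (Fin n) ℝ}
    {Y : Fin K → EuclideanSpace ℝ (Fin m)} {S : Finset (Fin n)} {s : ℕ} (h : Errs Φ Y S s) :
    ∃ t ≤ s, ∃ T ∈ S.powersetCard t, ∃ j ∉ S, ∀ i,
      metric Φ (residual Φ T Y) i ≤ metric Φ (residual Φ T Y) j := by
  classical
  obtain ⟨j, hrun, herr⟩ := h
  obtain ⟨hts, hjt⟩ := Nat.find_spec herr
  have hmin : ∀ t' < Nat.find herr, j t' ∈ S := fun t' ht' ↦ by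
    by_contra hj
    exact Nat.find_min herr ht' ⟨ht'.le.trans hts, hj⟩
  -- The cardinality may be less than the iteration count, as an atom can be picked twice.
  refine ⟨(estSupport j (Nat.find herr)).card, ?_, estSupport j (Nat.find herr), ?_,
    j (Nat.find herr), hjt, hrun _ hts⟩
  · exact (Finset.card_image_le.trans (by simp)).trans hts
  · refine Finset.mem_powersetCard.2 ⟨fun i hi ↦ ?_, rfl⟩
    obtain ⟨t', ht', rfl⟩ := Finset.mem_image.1 hi
    exact hmin t' (Finset.mem_range.1 ht')

/-! ### Tail bounds and the probability of failure -/

section Tails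

variable {Ω : Type*} [MeasurableSpace Ω] {μ : Measure Ω} [IsProbabilityMeasure μ]
  {Φ : Matrix (Fin m) (Fin n) ℝ} {X : Matrix (Fin n) ℕ ℝ} {σ : ℕ → ℝ}
  {e : ℕ → Ω → EuclideanSpace ℝ (Fin m)}

lemma variance_residualAtom_le {T : Finset (Fin n)} {j : Fin n} (hj : ‖atom Φ j‖ = 1) (τ : ℝ) :
    ((τ ^ 2 * ‖residualAtom Φ T j‖ ^ 2).toNNReal : ℝ) ≤ τ ^ 2 := by
  rw [Real.coe_toNNReal _ (by positivity)]
  exact mul_le_of_le_one_right (sq_nonneg _)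
    (pow_le_one₀ (norm_nonneg _) (norm_residualAtom_le Φ T hj))

lemma measureReal_metric_ge_le (hσ : ∀ k, 0 ≤ σ k) (he : iIndepFun e μ)
    (he_law : ∀ k,
      HasLaw (e k) (multivariateGaussian 0 (σ k ^ 2 • (1 : Matrix (Fin m) (Fin m) ℝ))) μ)
    {K : ℕ} (hV : 0 < ∑ k ∈ Finset.range K, σ k ^ 2) (T : Finset (Fin n)) {j : Fin n}
    (hj : ‖atom Φ j‖ = 1) {ε : ℝ} (hε : 0 ≤ ε) :
    μ.real {w | metric Φ (residual Φ T (cleanMeas Φ X K)) j +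
        √(2 / Real.pi) * ∑ k ∈ Finset.range K, σ k + ε ≤
        metric Φ (residual Φ T (noisyMeas Φ X (fun k ↦ e k w) K)) j} ≤
      Real.exp (-(ε ^ 2 / (2 * ∑ k ∈ Finset.range K, σ k ^ 2))) := by
  simp only [metric_noisyMeas, metric_cleanMeas, Finset.mul_sum (Finset.range K) σ,
    ← Finset.sum_add_distrib]
  have hlaw := fun k ↦ hasLaw_inner_gaussian (he_law k) (residualAtom Φ T j)
  refine measureReal_sum_ge_le (Z := fun k w ↦
    |⟪residualAtom Φ T j, WithLp.toLp 2 (Φ.mulVec fun j => X j k)⟫ + ⟪residualAtom Φ T j, e k w⟫|)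
    (he.comp (fun k y ↦ |⟪residualAtom Φ T j, WithLp.toLp 2 (Φ.mulVec fun j => X j k)⟫ +
      ⟪residualAtom Φ T j, y⟫|) fun k ↦ by fun_prop) (fun k ↦ ?_)
    (fun k t ↦ integrable_exp_mul_abs_const_add (hlaw k) _ t)
    (fun k t ht ↦ mgf_abs_const_add_le (hlaw k) _ (hσ k) (variance_residualAtom_le hj _) ht)
    (Finset.range K) hV hε
  have := (hlaw k).aemeasurable
  fun_prop

lemma measureReal_metric_le_le (he : iIndepFun e μ)
    (he_law : ∀ k,
      HasLaw (e k) (multivariateGaussian 0 (σ k ^ 2 • (1 : Matrix (Fin m) (Fin m) ℝ))) μ)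
    {K : ℕ} (hV : 0 < ∑ k ∈ Finset.range K, σ k ^ 2) (T : Finset (Fin n)) {j : Fin n}
    (hj : ‖atom Φ j‖ = 1) {ε : ℝ} (hε : 0 ≤ ε) :
    μ.real {w | metric Φ (residual Φ T (noisyMeas Φ X (fun k ↦ e k w) K)) j ≤
        metric Φ (residual Φ T (cleanMeas Φ X K)) j - ε} ≤
      Real.exp (-(ε ^ 2 / (2 * ∑ k ∈ Finset.range K, σ k ^ 2))) := by
  simp only [metric_noisyMeas, metric_cleanMeas]
  have hlaw := fun k ↦ hasLaw_inner_gaussian (he_law k) (residualAtom Φ T j)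
  refine le_trans (le_of_eq ?_) (measureReal_sum_ge_le (μ := μ) (Z := fun k w ↦
    -|⟪residualAtom Φ T j, WithLp.toLp 2 (Φ.mulVec fun j => X j k)⟫ + ⟪residualAtom Φ T j, e k w⟫|)
    (he.comp (fun k y ↦ -|⟪residualAtom Φ T j, WithLp.toLp 2 (Φ.mulVec fun j => X j k)⟫ +
      ⟪residualAtom Φ T j, y⟫|) fun k ↦ by fun_prop) (fun k ↦ ?_)
    (fun k t ↦ ?_)
    (fun k t ht ↦ mgf_neg_abs_const_add_le (hlaw k) _ (variance_residualAtom_le hj _) ht)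
    (Finset.range K) hV hε)
  · congr 1
    ext w
    simp only [Set.mem_ofPred_eq, Finset.sum_neg_distrib]
    constructor <;> intro h <;> linarith
  · have := (hlaw k).aemeasurable
    fun_prop
  · simpa using integrable_exp_mul_abs_const_add (hlaw k)
      ⟪residualAtom Φ T j, WithLp.toLp 2 (Φ.mulVec fun j => X j k)⟫ (-t)

lemma exists_metric_eq_gammaC (hS : (jointSupport X).Nonempty) (K : ℕ) (T : Finset (Fin n)) :
    ∃ j, metric Φ (residual Φ T (cleanMeas Φ X K)) j = gammaC Φ X K T := by
  have : Nonempty {j : Fin n // j ∈ jointSupport X} := hS.to_subtype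
  obtain ⟨j, hj⟩ := exists_eq_ciSup_of_finite
    (f := fun j : {j : Fin n // j ∈ jointSupport X} ↦ metric Φ (residual Φ T (cleanMeas Φ X K)) j)
  exact ⟨j, hj⟩

lemma metric_le_gammaI (K : ℕ) (T : Finset (Fin n)) {j : Fin n} (hj : j ∉ jointSupport X) :
    metric Φ (residual Φ T (cleanMeas Φ X K)) j ≤ gammaI Φ X K T :=
  le_ciSup (f := fun j : {j : Fin n // j ∉ jointSupport X} ↦
    metric Φ (residual Φ T (cleanMeas Φ X K)) j) (Set.finite_range _).bddAbove ⟨j, hj⟩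

/-- A wrong decision for the projector of `T` requires that either the best correct atom falls
short of its noiseless metric by half the margin, or some incorrect atom exceeds its own by half the
margin plus the mean modulus of the noise. -/
lemma measureReal_wrong_le (hΦ : ∀ j, ‖atom Φ j‖ = 1) (hσ : ∀ k, 0 ≤ σ k) (hσ₀ : 0 < σ 0)
    (he : iIndepFun e μ)
    (he_law : ∀ k,
      HasLaw (e k) (multivariateGaussian 0 (σ k ^ 2 • (1 : Matrix (Fin m) (Fin m) ℝ))) μ)
    (hS : (jointSupport X).Nonempty) {Γ ψ : ℝ} (hΓ : 1 < Γ) (hξ : 0 < xi X σ Γ ψ)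
    {K : ℕ} (hK : 1 ≤ K) {T : Finset (Fin n)} (h1 : Γ * gammaI Φ X K T ≤ gammaC Φ X K T)
    (h2 : ψ * tauX X K ≤ gammaC Φ X K T) :
    μ.real {w | ∃ j ∉ jointSupport X, ∀ i,
        metric Φ (residual Φ T (noisyMeas Φ X (fun k ↦ e k w) K)) i ≤
          metric Φ (residual Φ T (noisyMeas Φ X (fun k ↦ e k w) K)) j} ≤
      n * Real.exp (-(K * xi X σ Γ ψ ^ 2 / 8)) := by
  classical
  have hV := sum_range_sq_pos hσ₀ hK
  have hmargin := xi_mul_le_gammaC_sub Φ X hσ hσ₀ hΓ hξ hK h1 h2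
  set V := ∑ k ∈ Finset.range K, σ k ^ 2
  set ε := √(K * V) * xi X σ Γ ψ / 2 with hε
  have hε0 : 0 ≤ ε := by positivity
  have hexp : ε ^ 2 / (2 * V) = K * xi X σ Γ ψ ^ 2 / 8 := by
    rw [hε, div_pow, mul_pow, Real.sq_sqrt (by positivity)]
    field_simp
    norm_num
  obtain ⟨c, hc⟩ := exists_metric_eq_gammaC (Φ := Φ) hS K T
  -- The event about the best correct atom is repeated for every index in the support: as there is
  -- at least one such index, the union bound over all `n` indices pays for it.
  let B : Fin n → Set Ω := fun j ↦
    if j ∈ jointSupport X then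
      {w | metric Φ (residual Φ T (noisyMeas Φ X (fun k ↦ e k w) K)) c ≤
        metric Φ (residual Φ T (cleanMeas Φ X K)) c - ε}
    else
      {w | metric Φ (residual Φ T (cleanMeas Φ X K)) j +
        √(2 / Real.pi) * ∑ k ∈ Finset.range K, σ k + ε ≤
        metric Φ (residual Φ T (noisyMeas Φ X (fun k ↦ e k w) K)) j}
  have hB : ∀ j, μ.real (B j) ≤ Real.exp (-(K * xi X σ Γ ψ ^ 2 / 8)) := by
    intro j
    rw [← hexp]
    by_cases hj : j ∈ jointSupport X
    · simp only [B, if_pos hj]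
      exact measureReal_metric_le_le he he_law hV T (hΦ c) hε0
    · simp only [B, if_neg hj]
      exact measureReal_metric_ge_le hσ he he_law hV T (hΦ j) hε0
  calc _ ≤ μ.real (⋃ j ∈ Finset.univ, B j) := by
        refine measureReal_mono (fun w hw ↦ ?_) (measure_ne_top _ _)
        obtain ⟨j, hj, hmax⟩ := hw
        simp only [Finset.mem_univ, Set.iUnion_true, Set.mem_iUnion]
        by_contra! hnot
        have hcor : ¬ metric Φ (residual Φ T (noisyMeas Φ X (fun k ↦ e k w) K)) c ≤
            metric Φ (residual Φ T (cleanMeas Φ X K)) c - ε := by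
          obtain ⟨i, hi⟩ := hS
          have := hnot i
          simpa only [B, if_pos hi, Set.mem_ofPred_eq] using this
        have hinc := hnot j
        simp only [B, if_neg hj, Set.mem_ofPred_eq] at hinc
        have := hmax c
        have := metric_le_gammaI (Φ := Φ) K T hj
        rw [hc] at hcor
        linarith
    _ ≤ ∑ j, μ.real (B j) := measureReal_biUnion_finset_le _ _
    _ ≤ ∑ _j : Fin n, Real.exp (-(K * xi X σ Γ ψ ^ 2 / 8)) := Finset.sum_le_sum fun j _ ↦ hB j
    _ = _ := by simp

/-- Union bound over the supports that the algorithm may have built before its first error. The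
error event need not be measurable: only monotonicity and subadditivity of the outer measure are
used. -/
lemma failProb_le (hΦ : ∀ j, ‖atom Φ j‖ = 1) (hσ : ∀ k, 0 ≤ σ k) (hσ₀ : 0 < σ 0)
    (he : iIndepFun e μ)
    (he_law : ∀ k,
      HasLaw (e k) (multivariateGaussian 0 (σ k ^ 2 • (1 : Matrix (Fin m) (Fin m) ℝ))) μ)
    (hS : (jointSupport X).Nonempty) {s : ℕ} {Γ ψ : ℝ} (hΓ : 1 < Γ) (hξ : 0 < xi X σ Γ ψ)
    {K : ℕ} (hK : 1 ≤ K) (h1 : RelativelyReliable Φ X s Γ K) (h2 : CorrectMetricBound Φ X s ψ K) :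
    failProb μ Φ X e s K ≤
      n * numProj (jointSupport X).card s * Real.exp (-(K * xi X σ Γ ψ ^ 2 / 8)) := by
  let B : Finset (Fin n) → Set Ω := fun T ↦ {w | ∃ j ∉ jointSupport X, ∀ i,
    metric Φ (residual Φ T (noisyMeas Φ X (fun k ↦ e k w) K)) i ≤
      metric Φ (residual Φ T (noisyMeas Φ X (fun k ↦ e k w) K)) j}
  calc failProb μ Φ X e s K
      ≤ μ.real (⋃ t ∈ Finset.range (s + 1), ⋃ T ∈ (jointSupport X).powersetCard t, B T) := by
        refine measureReal_mono (fun w hw ↦ ?_) (measure_ne_top _ _)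
        obtain ⟨t, ht, T, hT, j, hj, hmax⟩ := Errs.exists_first hw
        simp only [Set.mem_iUnion]
        exact ⟨t, Finset.mem_range.2 (by omega), T, hT, j, hj, hmax⟩
    _ ≤ ∑ t ∈ Finset.range (s + 1), ∑ T ∈ (jointSupport X).powersetCard t, μ.real (B T) :=
        (measureReal_biUnion_finset_le _ _).trans
          (Finset.sum_le_sum fun _ _ ↦ measureReal_biUnion_finset_le _ _)
    _ ≤ ∑ t ∈ Finset.range (s + 1), ∑ T ∈ (jointSupport X).powersetCard t,
          n * Real.exp (-(K * xi X σ Γ ψ ^ 2 / 8)) := by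
        refine Finset.sum_le_sum fun t ht ↦ Finset.sum_le_sum fun T hT ↦ ?_
        have ht' : t ≤ s := Nat.lt_succ_iff.1 (Finset.mem_range.1 ht)
        exact measureReal_wrong_le hΦ hσ hσ₀ he he_law hS hΓ hξ hK (h1 t ht' T hT) (h2 t ht' T hT)
    _ = _ := by
        simp only [Finset.sum_const, Finset.card_powersetCard, nsmul_eq_mul, ← Finset.sum_mul,
          numProj, Nat.cast_sum]
        ring

end Tails

lemma numProj_pos (r s : ℕ) : 0 < numProj r s :=
  Finset.sum_pos' (fun _ _ ↦ Nat.zero_le _) ⟨0, by simp, by simp⟩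

lemma mul_exp_lt_of_kMin_lt {X : Matrix (Fin n) ℕ ℝ} {σ : ℕ → ℝ} {s : ℕ} {Γ ψ p : ℝ}
    (hn : 0 < n) (hξ : 0 < xi X σ Γ ψ) (hp : 0 < p) {K : ℕ} (hK : kMin X σ s Γ ψ p < K) :
    n * numProj (jointSupport X).card s * Real.exp (-(K * xi X σ Γ ψ ^ 2 / 8)) < p := by
  have hn' : (0 : ℝ) < n := by exact_mod_cast hn
  have hC : (0 : ℝ) < numProj (jointSupport X).card s := by exact_mod_cast numProj_pos _ _
  rw [kMin, div_mul_eq_mul_div, div_lt_iff₀ (by positivity)] at hK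
  have h : Real.log (n * numProj (jointSupport X).card s / p) < K * xi X σ Γ ψ ^ 2 / 8 := by
    linarith
  rw [Real.log_lt_iff_lt_exp (by positivity), div_lt_iff₀ hp] at h
  rw [Real.exp_neg, ← div_eq_mul_inv, div_lt_iff₀ (Real.exp_pos _)]
  linarith

end SOMP

theorem mainTheorem3 {Ω : Type*} [MeasurableSpace Ω] (μ : Measure Ω) [IsProbabilityMeasure μ]
    {m n : ℕ} (Φ : Matrix (Fin m) (Fin n) ℝ) (hΦ : ∀ j, ‖SOMP.atom Φ j‖ = 1)
    (X : Matrix (Fin n) ℕ ℝ)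
    (σ : ℕ → ℝ) (hσ : ∀ k, 0 ≤ σ k) (hσ₀ : 0 < σ 0)
    (e : ℕ → Ω → EuclideanSpace ℝ (Fin m)) (he : iIndepFun e μ)
    (he_law : ∀ k, HasLaw (e k) (multivariateGaussian 0 (σ k ^ 2 • (1 : Matrix (Fin m) (Fin m) ℝ))) μ)
    (s : ℕ) (hs : s < (SOMP.jointSupport X).card) :
    (∀ Γ ψ : ℝ, 1 < Γ → 0 < SOMP.xi X σ Γ ψ →
      (∀ K : ℕ, 1 ≤ K → SOMP.RelativelyReliable Φ X s Γ K → SOMP.CorrectMetricBound Φ X s ψ K →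
        SOMP.failProb μ Φ X e s K ≤
            n * SOMP.numProj (SOMP.jointSupport X).card s *
              Real.exp (-(K * SOMP.xi X σ Γ ψ ^ 2 / 8)) ∧
        ∀ p : ℝ, 0 < p → SOMP.kMin X σ s Γ ψ p < K → SOMP.failProb μ Φ X e s K < p) ∧
      ((∀ᶠ K : ℕ in atTop,
          SOMP.RelativelyReliable Φ X s Γ K ∧ SOMP.CorrectMetricBound Φ X s ψ K) →
        Tendsto (fun K : ℕ => SOMP.failProb μ Φ X e s K) atTop (𝓝 0))) ∧
    (SOMP.ric Φ (SOMP.jointSupport X).card < 1 →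
      ∀ K : ℕ, 1 ≤ K →
        SOMP.CorrectMetricBound Φ X s (SOMP.psiRIC Φ (SOMP.jointSupport X).card) K) := by
  have hS : (SOMP.jointSupport X).Nonempty := Finset.card_pos.1 (by omega)
  have hn : 0 < n := Fin.pos hS.choose
  refine ⟨fun Γ ψ hΓ hξ ↦ ⟨fun K hK h1 h2 ↦ ?_, fun hev ↦ ?_⟩, fun hδ K _ ↦
    SOMP.correctMetricBound_psiRIC Φ hΦ X hs hδ K⟩
  · have h := SOMP.failProb_le hΦ hσ hσ₀ he he_law hS hΓ hξ hK h1 h2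
    exact ⟨h, fun p hp hKp ↦ h.trans_lt (SOMP.mul_exp_lt_of_kMin_lt hn hξ hp hKp)⟩
  · have hlim : Tendsto (fun K : ℕ ↦ n * SOMP.numProj (SOMP.jointSupport X).card s *
        Real.exp (-(K * SOMP.xi X σ Γ ψ ^ 2 / 8))) atTop (𝓝 0) := by
      rw [← mul_zero ((n : ℝ) * SOMP.numProj (SOMP.jointSupport X).card s)]
      refine (Real.tendsto_exp_neg_atTop_nhds_zero.comp ?_).const_mul _
      exact (tendsto_natCast_atTop_atTop.atTop_mul_const (by positivity)).atTop_div_const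
        (by norm_num)
    refine squeeze_zero' (.of_forall fun K ↦ measureReal_nonneg) ?_ hlim
    filter_upwards [hev, eventually_ge_atTop 1] with K hK hK1
    exact SOMP.failProb_le hΦ hσ hσ₀ he he_law hS hΓ hξ hK1 hK.1 hK.2
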